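/- An absolute-valued real algebra is a real vector space $A$ with a bilinear (not necessarily associative or unital) product and a norm $\|\cdot\|$ such that $\|xy\|=\|x\|\,\|y\|$ for all $x,y\in A$. Write $x^2=xx$ and $(x,y,z)=(xy)z-x(yz)$. Let $\mathbb H$ be the algebra of real quaternions with its Euclidean norm, standard involution $x\mapsto\bar x$ and canonical basis $1,i,j,k$. Let $\mathbb H^*$ be the normed space $\mathbb H$ with the product $x\odot y=x\bar y$, and, for norm-one $a,b\in\mathbb H$, let $\mathbb H^*(a,b)$ be the normed space $\mathbb H$ with the product $x\odot y=axb\bar y$. Theorem 3.15. For a $4$-dimensional absolute-valued real algebra $A$ the following are equivalent: 1. $(x,x^2,x^2)=0$ for all $x\in A$; 2. $A$ is isomorphic, as an algebra, to $\mathbb H$, $\mathbb H^*$ or $\mathbb H^*(1,i)$. -/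

import Mathlib

open scoped Quaternion

noncomputable section

/-- A structure of absolute-valued real algebra on a real normed space `A`: a (not necessarily
associative or unital) bilinear product for which the norm is multiplicative. -/
structure AbsoluteValuedAlgebra (A : Type*) [NormedAddCommGroup A] [NormedSpace ℝ A] where
  /-- The product. -/
  mul : A →ₗ[ℝ] A →ₗ[ℝ] A
  norm_mul : ∀ x y : A, ‖mul x y‖ = ‖x‖ * ‖y‖

namespace AbsoluteValuedAlgebra

section General

variable {A B : Type*} [NormedAddCommGroup A] [NormedSpace ℝ A]
  [NormedAddCommGroup B] [NormedSpace ℝ B]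

/-- The square `x² = xx`. -/
def square (P : AbsoluteValuedAlgebra A) (x : A) : A := P.mul x x

/-- The associator `(x, y, z) = (xy)z - x(yz)`. -/
def assoc (P : AbsoluteValuedAlgebra A) (x y z : A) : A :=
  P.mul (P.mul x y) z - P.mul x (P.mul y z)

/-- Isomorphism of algebras: a linear bijection that preserves the products. -/
def Isomorphic (P : AbsoluteValuedAlgebra A) (Q : AbsoluteValuedAlgebra B) : Prop :=
  ∃ φ : A ≃ₗ[ℝ] B, ∀ x y : A, φ (P.mul x y) = Q.mul (φ x) (φ y)

end General

/-- The algebra `ℍ` of real quaternions, with its Euclidean norm. -/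
def quaternion : AbsoluteValuedAlgebra ℍ[ℝ] where
  mul := LinearMap.mk₂ ℝ (fun x y => x * y) add_mul smul_mul_assoc mul_add
    (fun c x y => mul_smul_comm c x y)
  norm_mul x y := by simp

/-- The standard isotope `ℍ*`: the normed space `ℍ` with the product `x ⊙ y = x ȳ`. -/
def quaternionStar : AbsoluteValuedAlgebra ℍ[ℝ] where
  mul := LinearMap.mk₂ ℝ (fun x y => x * star y)
    (by intros; simp [add_mul]) (by intros; simp) (by intros; simp [mul_add]) (by intros; simp)
  norm_mul x y := by simp

/-- The principal isotope `ℍ*(a, b)`, for norm-one `a` and `b`: the normed space `ℍ` with the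
product `x ⊙ y = a x b ȳ`. -/
def principalStar (a b : ℍ[ℝ]) (ha : ‖a‖ = 1) (hb : ‖b‖ = 1) : AbsoluteValuedAlgebra ℍ[ℝ] where
  mul := LinearMap.mk₂ ℝ (fun x y => a * x * b * star y)
    (by intros; simp [mul_add, add_mul]) (by intros; simp)
    (by intros; simp [mul_add]) (by intros; simp)
  norm_mul x y := by simp [ha, hb]

/-- The first imaginary unit `i` of the canonical basis `1, i, j, k` of `ℍ`. -/
def quatI : ℍ[ℝ] := ⟨0, 1, 0, 0⟩

theorem norm_quatI : ‖quatI‖ = 1 := by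
  have h : ‖quatI‖ * ‖quatI‖ = 1 := by
    rw [← Quaternion.normSq_eq_norm_mul_self, Quaternion.normSq_def']
    norm_num [quatI]
  nlinarith [norm_nonneg quatI]

end AbsoluteValuedAlgebra

end

/-! ### Invariant Euclidean structure from transitivity of isometries. -/

section InvariantForm

open MeasureTheory Metric

variable {E : Type*} [NormedAddCommGroup E] [NormedSpace ℝ E] [FiniteDimensional ℝ E]

/-! Multiplications by norm-one elements are isometries, and they make the isometry group of `A`
transitive on the unit sphere; averaging over the unit ball then shows that the norm is Euclidean
(`parallelogram_law`). Dividing by `R_e` and `L_e` for a unit vector `e` makes the product unital,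
and a Clifford-relation argument identifies the result with `ℍ`
(`exists_quaternion_equiv_of_norm_mul`). Hence the product of `A` is `f(x)g(y)` on `ℍ` with
isometries `f`, `g`, each of the form `p x q` or `p x̄ q`. A change of variable leaves four normal
forms with two parameters `a`, `b` (`exists_normal_form`).

On norm-one quaternions conjugation is inversion, so `(x, x², x²) = 0` becomes an identity in a
group. For `a x y b` it makes `a` and `b` central, hence `±1`; for `a x b ȳ` it gives `a = ±1` and
`b²` central, so `b = ±1` or `b` is conjugate to `i`; for `x̄ a y b` and `a x̄ ȳ b` it is
contradictory. Signs are absorbed by `x ↦ -x`. -/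

theorem LinearIsometryEquiv.measurePreserving_addHaar [MeasurableSpace E] [BorelSpace E]
    (μ : Measure E) [μ.IsAddHaarMeasure] (g : E ≃ₗᵢ[ℝ] E) : MeasurePreserving g μ μ := by
  have hpos : μ (closedBall (0 : E) 1) ≠ 0 := (measure_closedBall_pos μ 0 one_pos).ne'
  have hfin : μ (closedBall (0 : E) 1) ≠ ⊤ := measure_closedBall_lt_top.ne
  have hdet : LinearMap.det (g.toLinearEquiv : E →ₗ[ℝ] E) ≠ 0 :=
    (LinearEquiv.isUnit_det' g.toLinearEquiv).ne_zero
  have hmap := Measure.map_linearMap_addHaar_eq_smul_addHaar μ hdet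
  have hcoe : ((g.toLinearEquiv : E →ₗ[ℝ] E) : E → E) = g := rfl
  rw [hcoe] at hmap
  refine ⟨g.continuous.measurable, ?_⟩
  -- The image measure is a multiple of `μ`; since `g` preserves the unit ball, the factor is 1.
  have hball := congrArg (fun ν : Measure E => ν (closedBall (0 : E) 1)) hmap
  simp only [Measure.smul_apply, smul_eq_mul] at hball
  rw [Measure.map_apply g.continuous.measurable measurableSet_closedBall,
    g.preimage_closedBall, map_zero] at hball
  have hone := (ENNReal.mul_eq_right hpos hfin).1 hball.symm
  rw [hmap, hone, one_smul]

/-- If the linear isometries of a finite-dimensional normed space act transitively on the unit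
sphere, then the norm comes from a bilinear form. -/
theorem exists_bilin_self_eq_sq_norm_of_transitive
    (h : ∀ x y : E, ‖x‖ = 1 → ‖y‖ = 1 → ∃ g : E ≃ₗᵢ[ℝ] E, g x = y) :
    ∃ b : E →ₗ[ℝ] E →ₗ[ℝ] ℝ, ∀ x, b x x = ‖x‖ ^ 2 := by
  let _ : MeasurableSpace E := borel E
  have : BorelSpace E := ⟨rfl⟩
  set μ : Measure E := Measure.addHaar
  have hint : ∀ u : E → E, Continuous u → IntegrableOn u (closedBall (0 : E) 1) μ := fun u hu =>
    hu.continuousOn.integrableOn_compact (isCompact_closedBall 0 1)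
  have hc : ∀ f : Module.Dual ℝ E, Continuous f := fun f => f.continuous_of_finiteDimensional
  -- The second-moment map of the unit ball: symmetric, positive definite, and equivariant under
  -- isometries. Its inverse is an invariant inner product on `E`, which transitivity forces to be a
  -- multiple of the squared norm.
  let T : Module.Dual ℝ E →ₗ[ℝ] E :=
    { toFun := fun f => ∫ x in closedBall (0 : E) 1, f x • x ∂μ
      map_add' := fun f f' => by
        simp only [LinearMap.add_apply, add_smul]
        exact integral_add (hint _ ((hc f).smul continuous_id))
          (hint _ ((hc f').smul continuous_id))
      map_smul' := fun c f => by
        simp only [LinearMap.smul_apply, smul_assoc, RingHom.id_apply]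
        exact integral_smul c _ }
  have hT : ∀ f, T f = ∫ x in closedBall (0 : E) 1, f x • x ∂μ := fun f => rfl
  have happ : ∀ f f' : Module.Dual ℝ E,
      f (T f') = ∫ x in closedBall (0 : E) 1, f' x * f x ∂μ := by
    intro f f'
    have := (LinearMap.toContinuousLinearMap f).integral_comp_comm (μ := μ.restrict (closedBall (0 : E) 1))
      (hint _ ((hc f').smul continuous_id))
    simpa [hT] using this.symm
  have hpos : ∀ f : Module.Dual ℝ E, f ≠ 0 → 0 < f (T f) := by
    intro f hf
    rw [happ]
    have hnn : 0 ≤ f (T f) := by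
      rw [happ]; exact integral_nonneg fun x => mul_self_nonneg _
    rw [happ] at hnn
    refine lt_of_le_of_ne hnn fun h0 => hf ?_
    have hz := (setIntegral_eq_zero_iff_of_nonneg_ae
      (Filter.Eventually.of_forall fun x => mul_self_nonneg (f x))
      (((hc f).mul (hc f)).continuousOn.integrableOn_compact (isCompact_closedBall 0 1))).1 h0.symm
    -- Almost-everywhere equality of continuous functions becomes equality on an open set, hence the
    -- open ball.
    have hz' : (fun x => f x * f x) =ᵐ[μ.restrict (ball (0 : E) 1)] fun _ => 0 :=
      ae_restrict_of_ae_restrict_of_subset ball_subset_closedBall hz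
    have hEq := Measure.eqOn_open_of_ae_eq hz' isOpen_ball
      ((hc f).mul (hc f)).continuousOn continuousOn_const
    ext x
    by_contra hx
    have hx0 : x ≠ 0 := by rintro rfl; simp at hx
    have hn : 0 < ‖x‖ := norm_pos_iff.2 hx0
    have hmem : (2 * ‖x‖)⁻¹ • x ∈ ball (0 : E) 1 := by
      rw [mem_ball_zero_iff, norm_smul, norm_inv, Real.norm_of_nonneg (by positivity)]
      field_simp; norm_num
    have := hEq hmem
    simp at this
    rcases this with h1 | h1
    · exact hx0 h1
    · exact hx h1
  have hinj : Function.Injective T := by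
    rw [← LinearMap.ker_eq_bot, LinearMap.ker_eq_bot']
    intro f hf
    by_contra hne
    have := hpos f hne
    rw [hf, map_zero] at this
    exact lt_irrefl _ this
  let e : Module.Dual ℝ E ≃ₗ[ℝ] E := LinearEquiv.ofInjectiveOfFinrankEq T hinj
    (Subspace.dual_finrank_eq)
  have he : ∀ f, e f = T f := fun f => rfl
  have hinv : ∀ (g : E ≃ₗᵢ[ℝ] E) x, e.symm (g x) (g x) = e.symm x x := by
    intro g x
    obtain ⟨f, rfl⟩ := e.surjective x
    have hg : g (e f) = e (f ∘ₗ (g.symm.toLinearEquiv : E →ₗ[ℝ] E)) := by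
      rw [he, he, hT, hT]
      have h1 := (g.toContinuousLinearEquiv : E →L[ℝ] E).integral_comp_comm
        (μ := μ.restrict (closedBall (0 : E) 1)) (hint _ ((hc f).smul continuous_id))
      have h2 := ((LinearIsometryEquiv.measurePreserving_addHaar μ g).setIntegral_preimage_emb
        g.toHomeomorph.measurableEmbedding (fun x => f (g.symm x) • x) (closedBall (0 : E) 1))
      rw [g.preimage_closedBall, map_zero] at h2
      simp at h1 h2
      rw [← h1, h2]
      rfl
    rw [hg]
    simp only [LinearEquiv.symm_apply_apply]
    rw [← hg]
    simp
  by_cases htriv : ∀ x : E, x = 0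
  · exact ⟨0, fun x => by simp [htriv x]⟩
  push Not at htriv
  obtain ⟨v, hv⟩ := htriv
  set u : E := ‖v‖⁻¹ • v
  have hu : ‖u‖ = 1 := norm_smul_inv_norm (𝕜 := ℝ) hv
  set c := e.symm u u
  have hcpos : 0 < c := by
    have hne : e.symm u ≠ 0 := fun h0 => by
      have : u = 0 := by simpa using h0
      rw [this] at hu; simp at hu
    have := hpos _ hne
    rwa [← he, LinearEquiv.apply_symm_apply] at this
  refine ⟨c⁻¹ • (e.symm : E →ₗ[ℝ] Module.Dual ℝ E), fun x => ?_⟩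
  by_cases hx : x = 0
  · simp [hx]
  obtain ⟨g, hg⟩ := h u (‖x‖⁻¹ • x) hu (norm_smul_inv_norm (𝕜 := ℝ) hx)
  have h1 := hinv g u
  rw [hg] at h1
  simp only [map_smul, LinearMap.smul_apply, smul_eq_mul] at h1
  have hxn : ‖x‖ ≠ 0 := norm_ne_zero_iff.2 hx
  simp only [LinearMap.smul_apply, smul_eq_mul, LinearEquiv.coe_coe]
  change _ = c at h1
  rw [← h1]
  have : e.symm x x ≠ 0 := by
    intro h0; rw [h0] at h1; simp at h1; exact hcpos.ne h1
  field_simp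

end InvariantForm

/-! ### Four-dimensional Hurwitz theorem. -/

section Hurwitz

open scoped RealInnerProductSpace

variable {E : Type*} [NormedAddCommGroup E] [InnerProductSpace ℝ E]
  {m : E →ₗ[ℝ] E →ₗ[ℝ] E}

theorem inner_mul_mul_of_norm_mul (hm : ∀ x y, ‖m x y‖ = ‖x‖ * ‖y‖) (x y z : E) :
    ⟪m x y, m x z⟫ = ‖x‖ ^ 2 * ⟪y, z⟫ := by
  have h := hm x (y + z)
  have h2 : ‖m x y + m x z‖ ^ 2 = ‖x‖ ^ 2 * ‖y + z‖ ^ 2 := by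
    rw [← map_add, h, mul_pow]
  rw [norm_add_sq_real, norm_add_sq_real, hm, hm] at h2
  linarith [h2]

theorem inner_mul_mul_add_of_norm_mul (hm : ∀ x y, ‖m x y‖ = ‖x‖ * ‖y‖) (x w y z : E) :
    ⟪m x y, m w z⟫ + ⟪m w y, m x z⟫ = 2 * ⟪x, w⟫ * ⟪y, z⟫ := by
  have h := inner_mul_mul_of_norm_mul hm (x + w) y z
  simp only [map_add, LinearMap.add_apply, inner_add_left, inner_add_right,
    inner_mul_mul_of_norm_mul hm, norm_add_sq_real] at h
  linarith

theorem inner_mul_left_skew {e : E} (hm : ∀ x y, ‖m x y‖ = ‖x‖ * ‖y‖) (he : ∀ x, m e x = x)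
    {u : E} (hu : ⟪u, e⟫ = 0) (y z : E) : ⟪m u y, z⟫ = -⟪y, m u z⟫ := by
  have h := inner_mul_mul_add_of_norm_mul hm u e y z
  rw [he, he, hu] at h
  linarith

/-- The Clifford relation: polarize the norm identity in both factors, then move `L_u` and `L_v`
across the inner product by skewness. It replaces associativity in what follows. -/
theorem mul_mul_add_mul_mul {e : E} (hm : ∀ x y, ‖m x y‖ = ‖x‖ * ‖y‖) (he : ∀ x, m e x = x)
    {u v : E} (hu : ⟪u, e⟫ = 0) (hv : ⟪v, e⟫ = 0) (y : E) :
    m u (m v y) + m v (m u y) = -(2 * ⟪u, v⟫) • y := by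
  refine ext_inner_right ℝ fun z => ?_
  rw [inner_add_left, real_inner_smul_left]
  have h := inner_mul_mul_add_of_norm_mul hm u v y z
  have h1 := inner_mul_left_skew hm he hv (m u y) z
  have h2 := inner_mul_left_skew hm he hu (m v y) z
  linarith

theorem mul_mul_self_neg {e : E} (hm : ∀ x y, ‖m x y‖ = ‖x‖ * ‖y‖) (he : ∀ x, m e x = x)
    {u : E} (hu : ⟪u, e⟫ = 0) (hu1 : ‖u‖ = 1) (y : E) : m u (m u y) = -y := by
  have h := mul_mul_add_mul_mul hm he hu hu y
  rw [real_inner_self_eq_norm_sq, hu1, ← two_smul ℝ (m u (m u y))] at h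
  have h2 : (2 : ℝ) • m u (m u y) = (2 : ℝ) • (-y) := by rw [h]; module
  exact smul_right_injective E (two_ne_zero) h2

theorem mul_mul_anticomm {e : E} (hm : ∀ x y, ‖m x y‖ = ‖x‖ * ‖y‖) (he : ∀ x, m e x = x)
    {u v : E} (hu : ⟪u, e⟫ = 0) (hv : ⟪v, e⟫ = 0) (huv : ⟪u, v⟫ = 0) (y : E) :
    m u (m v y) = -m v (m u y) := by
  have h := mul_mul_add_mul_mul hm he hu hv y
  rw [huv, mul_zero, neg_zero, zero_smul] at h
  exact eq_neg_of_add_eq_zero_left h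

/-- A four-dimensional unital Euclidean composition algebra is isometrically isomorphic to the
quaternions. -/
theorem exists_quaternion_equiv_of_norm_mul [FiniteDimensional ℝ E]
    (hdim : Module.finrank ℝ E = 4) {e : E} (hm : ∀ x y, ‖m x y‖ = ‖x‖ * ‖y‖)
    (he : ∀ x, m e x = x) (he' : ∀ x, m x e = x) :
    ∃ φ : ℍ[ℝ] ≃ₗ[ℝ] E, (∀ x y, φ (x * y) = m (φ x) (φ y)) ∧ ∀ x, ‖φ x‖ = ‖x‖ := by
  have hnt : Nontrivial E := Module.nontrivial_of_finrank_pos (R := ℝ) (by omega)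
  have he1 : ‖e‖ = 1 := by
    obtain ⟨v, hv⟩ := exists_ne (0 : E)
    have := hm e v
    rw [he] at this
    have hv' : ‖v‖ ≠ 0 := norm_ne_zero_iff.2 hv
    exact (mul_right_cancel₀ hv' (by rw [← this, one_mul])).symm
  have hexists : ∀ K : Submodule ℝ E, Module.finrank ℝ K ≤ 2 →
      ∃ v : E, ‖v‖ = 1 ∧ ∀ w ∈ K, ⟪w, v⟫ = 0 := by
    intro K hK
    have h1 := K.finrank_add_finrank_orthogonal
    have : Nontrivial Kᗮ := Module.nontrivial_of_finrank_pos (R := ℝ) (by omega)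
    obtain ⟨v, hv⟩ := exists_ne (0 : Kᗮ)
    have hv' : (v : E) ≠ 0 := by simpa using hv
    refine ⟨‖(v : E)‖⁻¹ • (v : E), norm_smul_inv_norm (𝕜 := ℝ) hv', fun w hw => ?_⟩
    rw [real_inner_smul_right, (Submodule.mem_orthogonal K _).1 v.2 w hw, mul_zero]
  obtain ⟨i, hi1, hi⟩ := hexists (ℝ ∙ e) ((finrank_span_singleton (K := ℝ) (v := e)
    (by rintro rfl; simp at he1)).le.trans one_le_two)
  obtain ⟨j, hj1, hj⟩ := hexists (Submodule.span ℝ {e, i}) (by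
    classical
    have := finrank_span_finset_le_card (R := ℝ) ({e, i} : Finset E)
    rw [Finset.coe_pair] at this
    exact this.trans Finset.card_le_two)
  have hei : ⟪e, i⟫ = 0 := hi e (Submodule.mem_span_singleton_self e)
  have hej : ⟪e, j⟫ = 0 := hj e (Submodule.subset_span (by simp))
  have hij : ⟪i, j⟫ = 0 := hj i (Submodule.subset_span (by simp))
  have hie : ⟪i, e⟫ = 0 := by rw [real_inner_comm]; exact hei
  have hje : ⟪j, e⟫ = 0 := by rw [real_inner_comm]; exact hej
  have hji : ⟪j, i⟫ = 0 := by rw [real_inner_comm]; exact hij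
  -- The whole multiplication table comes from Clifford relations for left multiplications, mostly
  -- evaluated at the right unit `e`.
  set k := m i j with hk
  have hk1 : ‖k‖ = 1 := by rw [hk, hm, hi1, hj1, one_mul]
  have hke : ⟪k, e⟫ = 0 := by
    rw [hk, inner_mul_left_skew hm he hie, he', hji, neg_zero]
  have hki : ⟪k, i⟫ = 0 := by
    have := inner_mul_mul_of_norm_mul hm i j e
    rwa [he', hje, mul_zero] at this
  have hii : m i i = -e := by
    have := mul_mul_self_neg hm he hie hi1 e; rwa [he'] at this
  have hjj : m j j = -e := by
    have := mul_mul_self_neg hm he hje hj1 e; rwa [he'] at this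
  have hkk : m k k = -e := by
    have := mul_mul_self_neg hm he hke hk1 e; rwa [he'] at this
  have hmji : m j i = -k := by
    have := mul_mul_anticomm hm he hje hie hji e; rwa [he', he'] at this
  have hik : m i k = -j := mul_mul_self_neg hm he hie hi1 j
  have hkj : ⟪k, j⟫ = 0 := by
    have h := inner_mul_left_skew hm he hje i j
    rw [hmji, hjj, inner_neg_left, inner_neg_right, hie] at h
    linarith
  have hmki : m k i = j := by
    have := mul_mul_anticomm hm he hke hie hki e
    rwa [he', he', hik, neg_neg] at this
  have hjk : m j k = i := by
    have h := mul_mul_anticomm hm he hje hie hji j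
    rw [← hk, hjj, map_neg, he', neg_neg] at h
    exact h
  have hmkj : m k j = -i := by
    have := mul_mul_anticomm hm he hke hje hkj e
    rwa [he', he', hjk] at this
  have hek : ⟪e, k⟫ = 0 := by rw [real_inner_comm]; exact hke
  have hik' : ⟪i, k⟫ = 0 := by rw [real_inner_comm]; exact hki
  have hjk' : ⟪j, k⟫ = 0 := by rw [real_inner_comm]; exact hkj
  have hee : ⟪e, e⟫ = 1 := by rw [real_inner_self_eq_norm_sq, he1, one_pow]
  have hii' : ⟪i, i⟫ = 1 := by rw [real_inner_self_eq_norm_sq, hi1, one_pow]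
  have hjj' : ⟪j, j⟫ = 1 := by rw [real_inner_self_eq_norm_sq, hj1, one_pow]
  have hkk' : ⟪k, k⟫ = 1 := by rw [real_inner_self_eq_norm_sq, hk1, one_pow]
  let f : ℍ[ℝ] →ₗ[ℝ] E :=
    { toFun := fun x => x.re • e + x.imI • i + x.imJ • j + x.imK • k
      map_add' := fun x y => by simp; module
      map_smul' := fun c x => by simp; module }
  have hf : ∀ x, f x = x.re • e + x.imI • i + x.imJ • j + x.imK • k := fun x => rfl
  have hnorm : ∀ x, ‖f x‖ = ‖x‖ := by
    intro x
    rw [← sq_eq_sq₀ (norm_nonneg _) (norm_nonneg _), ← real_inner_self_eq_norm_sq,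
      sq ‖x‖, ← Quaternion.normSq_eq_norm_mul_self, Quaternion.normSq_def', hf]
    simp only [inner_add_left, inner_add_right, real_inner_smul_left, real_inner_smul_right,
      hei, hej, hek, hie, hij, hik', hje, hji, hjk', hke, hki, hkj, hee, hii', hjj', hkk']
    ring
  have hinj : Function.Injective f := by
    rw [← LinearMap.ker_eq_bot, LinearMap.ker_eq_bot']
    intro x hx
    rw [← norm_eq_zero, ← hnorm, hx, norm_zero]
  refine ⟨LinearEquiv.ofInjectiveOfFinrankEq f hinj
    (by rw [hdim, Quaternion.finrank_eq_four]), fun x y => ?_, hnorm⟩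
  change f (x * y) = m (f x) (f y)
  simp only [hf, map_add, map_smul, LinearMap.add_apply, LinearMap.smul_apply, he, he', hii, hjj,
    hkk, hmji, hik, hmki, hjk, hmkj, ← hk, Quaternion.re_mul, Quaternion.imI_mul,
    Quaternion.imJ_mul, Quaternion.imK_mul]
  module

end Hurwitz

/-! ### Linear isometries of the quaternions. -/

section Isometries

namespace Quaternion

theorem self_mul_star_of_norm_eq_one {v : ℍ[ℝ]} (hv : ‖v‖ = 1) : v * star v = 1 := by
  rw [Quaternion.self_mul_star, Quaternion.normSq_eq_norm_mul_self, hv]; simp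

theorem star_mul_self_of_norm_eq_one {v : ℍ[ℝ]} (hv : ‖v‖ = 1) : star v * v = 1 := by
  rw [Quaternion.star_mul_self, Quaternion.normSq_eq_norm_mul_self, hv]; simp

theorem exists_unitary_smul_eq {v : ℍ[ℝ]} (hv : v ≠ 0) :
    ∃ u : unitary ℍ[ℝ], v = ‖v‖ • (u : ℍ[ℝ]) := by
  have h : ‖‖v‖⁻¹ • v‖ = 1 := norm_smul_inv_norm (𝕜 := ℝ) hv
  refine ⟨⟨‖v‖⁻¹ • v, Unitary.mem_iff.2 ⟨star_mul_self_of_norm_eq_one h,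
    self_mul_star_of_norm_eq_one h⟩⟩, ?_⟩
  rw [smul_inv_smul₀ (norm_ne_zero_iff.2 hv)]

theorem reflection_orthogonal_span_singleton {v : ℍ[ℝ]} (hv : ‖v‖ = 1) (x : ℍ[ℝ]) :
    (ℝ ∙ v)ᗮ.reflection x = -(v * star x * v) := by
  rw [Submodule.reflection_orthogonal_apply, Submodule.reflection_singleton_apply, hv]
  have h := star_mul_self_of_norm_eq_one hv
  have h2 : v * star x = (2 * inner ℝ v x) • (1 : ℍ[ℝ]) - x * star v := by
    rw [Quaternion.inner_def]
    ext <;> simp <;> ring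
  rw [h2, sub_mul, mul_assoc x, h, smul_mul_assoc, one_mul, mul_one]
  simp [two_mul, add_smul, two_smul]

/-- Every linear isometry of the quaternions is `x ↦ p x q` or `x ↦ p x̄ q` with `p`, `q` of
norm one. -/
theorem linearIsometryEquiv_eq_mul_mul (f : ℍ[ℝ] ≃ₗᵢ[ℝ] ℍ[ℝ]) :
    ∃ p q : unitary ℍ[ℝ], (∀ x, f x = p * x * q) ∨ (∀ x, f x = p * star x * q) := by
  obtain ⟨l, -, rfl⟩ := f.reflections_generate_dim
  induction l with
  | nil => exact ⟨1, 1, Or.inl fun x => by simp⟩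
  | cons v l ih =>
    obtain ⟨r, s, hh⟩ := ih
    rw [List.map_cons, List.prod_cons]
    generalize (l.map fun v : ℍ[ℝ] => (ℝ ∙ v)ᗮ.reflection).prod = h at hh ⊢
    -- The list of vectors may contain 0, whose reflection is the identity.
    by_cases hv : v = 0
    · subst hv
      have : ∀ x, ((ℝ ∙ (0 : ℍ[ℝ]))ᗮ.reflection * h) x = h x := fun x => by
        rw [LinearIsometryEquiv.coe_mul, Function.comp_apply, Submodule.reflection_orthogonal_apply,
          Submodule.reflection_singleton_apply]
        simp
      exact ⟨r, s, by simpa only [this] using hh⟩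
    · obtain ⟨u, hu⟩ := exists_unitary_smul_eq hv
      have hspan : (ℝ ∙ v) = ℝ ∙ (u : ℍ[ℝ]) := by
        rw [hu]
        exact Submodule.span_singleton_smul_eq (norm_ne_zero_iff.2 hv).isUnit _
      have hu1 : ‖(u : ℍ[ℝ])‖ = 1 := CStarRing.norm_coe_unitary u
      have key : ∀ x, ((ℝ ∙ v)ᗮ.reflection * h) x = -(u * star (h x) * u) := fun x => by
        rw [← reflection_orthogonal_span_singleton hu1, LinearIsometryEquiv.coe_mul,
          Function.comp_apply]
        simp only [hspan]
      -- A reflection `x ↦ -(u x̄ u)` exchanges the two forms.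
      refine ⟨-(u * star s), star r * u, ?_⟩
      rcases hh with hh | hh
      · exact Or.inr fun x => by simp [key, hh, mul_assoc, Unitary.coe_neg]
      · exact Or.inl fun x => by simp [key, hh, mul_assoc, Unitary.coe_neg]

end Quaternion

end Isometries

/-! ### Consequences of the associator identity in a group. -/

section GroupIdentities

variable {G : Type*} [Group G]

/-- For the product `x ⊙ y = a x y b`, the identity `(x, x², x²) = 0` at `1`. -/
theorem mul_comm_of_isotope {a b : G}
    (h : ∀ x : G, a * (a * x * (a * x * x * b) * b) * (a * x * x * b) * b
      = a * x * (a * (a * x * x * b) * (a * x * x * b) * b) * b) : a * b = b * a := by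
  have h1 := h 1
  simp only [mul_assoc, mul_one, mul_right_inj] at h1
  simp only [← mul_assoc, mul_left_inj] at h1
  exact h1.symm

theorem mul_comm_of_isotope_of_mul_self_eq_neg_one [HasDistribNeg G] {a b x : G}
    (hab : a * b = b * a) (hx : x * x = -1)
    (h : a * (a * x * (a * x * x * b) * b) * (a * x * x * b) * b
      = a * x * (a * (a * x * x * b) * (a * x * x * b) * b) * b) : a * x = x * a := by
  have hab' : ∀ y, b * (a * y) = a * (b * y) := fun y => by rw [← mul_assoc, ← hab, mul_assoc]
  have hx' : ∀ y, x * (x * y) = -y := fun y => by rw [← mul_assoc, hx, neg_one_mul]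
  simp only [mul_assoc, hx', mul_neg, neg_mul, neg_neg, mul_right_inj, hab'] at h
  rw [← mul_assoc, ← mul_assoc x a] at h
  exact mul_right_cancel h

theorem mul_mul_self_comm_of_isotope {a b x : G} (ha : ∀ y, a * y = y * a)
    (h : a * (a * x * (a * x * x * b) * b) * (a * x * x * b) * b
      = a * x * (a * (a * x * x * b) * (a * x * x * b) * b) * b) :
    b * (x * x) = x * x * b := by
  have h1 : a * a * a * a * (x * x * x * b * b * x * x * b * b) =
      a * a * a * a * (x * x * x * b * x * x * b * b * b) := by
    have ha' : ∀ y z, y * (a * z) = a * (y * z) := fun y z => by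
      rw [← mul_assoc, ← ha, mul_assoc]
    simp only [mul_assoc, ha'] at h ⊢
    exact h
  have h2 : x * x * x * b * b * x * x * b * b = x * x * x * b * x * x * b * b * b :=
    mul_left_cancel h1
  simp only [mul_assoc, mul_right_inj] at h2
  simp only [← mul_assoc, mul_left_inj] at h2
  simpa only [mul_assoc] using h2

/-- With `y = x b x⁻¹`, the elements `x` and `y x` have the same square `a y`. The identities at
these two points therefore differ only by a factor `y`, and comparing them gives `a y = y a`. -/
theorem comm_conj_of_star_isotope {a b : G}
    (h : ∀ x : G, a * (a * x * b * (a * x * b * x⁻¹)⁻¹) * b * (a * x * b * x⁻¹)⁻¹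
      = a * x * b * (a * (a * x * b * x⁻¹) * b * (a * x * b * x⁻¹)⁻¹)⁻¹) (x : G) :
    a * (x * b * x⁻¹) = x * b * x⁻¹ * a := by
  obtain ⟨y, rfl⟩ : ∃ y, b = x⁻¹ * y * x := ⟨x * b * x⁻¹, by group⟩
  have h1 := h x
  have h2 := h (y * x)
  simp [mul_assoc] at h1 h2
  rw [← h1, ← mul_assoc, ← mul_assoc y a] at h2
  simpa [mul_assoc] using mul_right_cancel h2

theorem mul_self_conj_of_star_isotope [HasDistribNeg G] {a b x : G} (ha : a = 1 ∨ a = -1)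
    (h : a * (a * x * b * (a * x * b * x⁻¹)⁻¹) * b * (a * x * b * x⁻¹)⁻¹
      = a * x * b * (a * (a * x * b * x⁻¹) * b * (a * x * b * x⁻¹)⁻¹)⁻¹) :
    x * (b * b) = b * b * x := by
  rcases ha with rfl | rfl <;>
  · simp [mul_assoc] at h
    have h1 : b⁻¹ * x⁻¹ * b = b * x⁻¹ * b⁻¹ := by
      refine mul_right_cancel (b := x * (b⁻¹ * x⁻¹)) ?_
      simpa only [mul_assoc] using h
    have h2 : x⁻¹ * (b * b) = b * b * x⁻¹ := by
      simpa [mul_assoc] using congrArg (fun z => b * z * b) h1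
    exact ((Commute.inv_left_iff (G := G)).1 h2).eq

theorem comm_of_star_isotope [HasDistribNeg G] {a b x : G} (hb : b = 1 ∨ b = -1)
    (h : a * (a * x * b * (a * x * b * x⁻¹)⁻¹) * b * (a * x * b * x⁻¹)⁻¹
      = a * x * b * (a * (a * x * b * x⁻¹) * b * (a * x * b * x⁻¹)⁻¹)⁻¹) :
    a * x = x * a := by
  rcases hb with rfl | rfl <;>
  · simp [mul_assoc] at h
    simpa [mul_assoc] using congrArg (fun z => z * (a * a)) h

/-- For the product `x ⊙ y = x⁻¹ a y b`, the identity `(x, x², x²) = 0` forces `a² = 1`. -/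
theorem mul_self_eq_one_of_inv_isotope {a b : G}
    (h : ∀ x : G, (x⁻¹ * a * (x⁻¹ * a * x * b) * b)⁻¹ * a * (x⁻¹ * a * x * b) * b
      = x⁻¹ * a * ((x⁻¹ * a * x * b)⁻¹ * a * (x⁻¹ * a * x * b) * b) * b) : a * a = 1 := by
  -- Here `y = x⁻¹ a x`, and `x`, `x y` have the same square `y b`; eliminating between the
  -- identities at both leaves a relation in `y` and `b⁻²`.
  have key : ∀ x y : G, a * x = x * y → y * (b⁻¹ * b⁻¹) * y⁻¹ = b⁻¹ * b⁻¹ * y⁻¹ * (x * y⁻¹ * x⁻¹) := by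
    intro x y hxy
    obtain rfl : a = x * y * x⁻¹ := by rw [← hxy]; group
    have h1 := h x
    have h2 := h (x * y)
    simp [mul_assoc] at h1 h2 ⊢
    rw [← h2] at h1
    have h3 : b⁻¹ * b⁻¹ * y⁻¹ * x * y⁻¹ = y * b⁻¹ * b⁻¹ * y⁻¹ * x := by
      refine mul_right_cancel (b := x * (y * (x⁻¹ * (y * (b * b))))) ?_
      simpa only [mul_assoc] using h1
    simpa [mul_assoc] using congrArg (fun z => z * x⁻¹) h3.symm
  generalize b⁻¹ * b⁻¹ = c at key
  have h1 := key 1 a (by group)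
  -- Conjugating the case `x = 1` by `c` and comparing it with the case `x = c` shows that `a` and
  -- `c` commute; the case `x = 1` then reads `a⁻² = 1`.
  have h2 := key c (c⁻¹ * a * c) (by group)
  simp [mul_assoc] at h1 h2
  have h3 : a⁻¹ * c = c * a⁻¹ := by
    have h4 := congrArg (fun z => c⁻¹ * z * c) h1
    simp only [mul_assoc, inv_mul_cancel_left] at h4
    rw [h4] at h2
    simpa using h2
  have h5 : a⁻¹ * a⁻¹ = 1 := by
    rw [← h3, mul_inv_cancel_left] at h1
    simpa using h1.symm
  rw [← mul_inv_rev, inv_eq_one] at h5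
  exact h5

theorem mul_self_eq_of_inv_isotope [HasDistribNeg G] {a b x : G} (ha : a = 1 ∨ a = -1)
    (h : (x⁻¹ * a * (x⁻¹ * a * x * b) * b)⁻¹ * a * (x⁻¹ * a * x * b) * b
      = x⁻¹ * a * ((x⁻¹ * a * x * b)⁻¹ * a * (x⁻¹ * a * x * b) * b) * b) : x * x = b * b := by
  rcases ha with rfl | rfl <;>
  · simp [mul_assoc] at h
    have h1 : b⁻¹ * b⁻¹ * x = x⁻¹ := by
      refine mul_right_cancel (b := b * b) ?_
      simpa only [mul_assoc] using h
    simpa [mul_assoc] using congrArg (fun z => b * b * z * x) h1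

/-- For the product `x ⊙ y = a x⁻¹ y⁻¹ b`, the identity `(x, x², x²) = 0` at `1` and at a square
root of `-1`. -/
theorem anticomm_of_inv_inv_isotope [HasDistribNeg G] {a b : G}
    (h : ∀ x : G, a * (a * x⁻¹ * (a * x⁻¹ * x⁻¹ * b)⁻¹ * b)⁻¹ * (a * x⁻¹ * x⁻¹ * b)⁻¹ * b
      = a * x⁻¹ * (a * (a * x⁻¹ * x⁻¹ * b)⁻¹ * (a * x⁻¹ * x⁻¹ * b)⁻¹ * b)⁻¹ * b)
    {x : G} (hx : x * x = -1) : b⁻¹ * a * b * x = -(x * (b⁻¹ * a * b)) := by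
  have hx' : ∀ y, x * (x * y) = -y := fun y => by rw [← mul_assoc, hx, neg_one_mul]
  have hinv : x⁻¹ = -x := inv_eq_of_mul_eq_one_right (by rw [mul_neg, hx, neg_neg])
  -- The squares at 1 and at `x` are `a b` and `-(a b)`, so the right-hand sides are directly
  -- comparable.
  have h1 := h 1
  have h2 := h x
  simp [mul_assoc, hinv, hx'] at h1 h2
  rw [h1] at h2
  have h3 : a * (b⁻¹ * (a * (b * x))) = -(a * (x * (b⁻¹ * (a * b)))) := by
    refine mul_right_cancel (b := a * (b * (a⁻¹ * b))) ?_
    simpa only [mul_assoc, neg_mul] using h2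
  rw [← mul_neg] at h3
  simpa only [mul_assoc] using mul_left_cancel h3

end GroupIdentities

/-! ### Reduction to isotopes of the quaternions. -/

noncomputable section

namespace AbsoluteValuedAlgebra

section Euclidean

variable {A : Type*} [NormedAddCommGroup A] [NormedSpace ℝ A] [FiniteDimensional ℝ A]

/-- Left multiplication by a norm-one element, as a linear isometry. -/
def mulLeftIsometry (P : AbsoluteValuedAlgebra A) (u : A) (hu : ‖u‖ = 1) : A ≃ₗᵢ[ℝ] A :=
  LinearIsometry.toLinearIsometryEquiv ⟨P.mul u, fun x => by rw [P.norm_mul, hu, one_mul]⟩ rfl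

/-- Right multiplication by a norm-one element, as a linear isometry. -/
def mulRightIsometry (P : AbsoluteValuedAlgebra A) (u : A) (hu : ‖u‖ = 1) : A ≃ₗᵢ[ℝ] A :=
  LinearIsometry.toLinearIsometryEquiv
    ⟨P.mul.flip u, fun x => by rw [LinearMap.flip_apply, P.norm_mul, hu, mul_one]⟩ rfl

/-- For unit vectors `x`, `y`, solve `z x = y` by surjectivity of `R_x`; then `L_z` is an isometry
taking `x` to `y`. -/
theorem parallelogram_law (P : AbsoluteValuedAlgebra A) (x y : A) :
    ‖x + y‖ * ‖x + y‖ + ‖x - y‖ * ‖x - y‖ = 2 * (‖x‖ * ‖x‖ + ‖y‖ * ‖y‖) := by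
  obtain ⟨b, hb⟩ := exists_bilin_self_eq_sq_norm_of_transitive (E := A) (fun x y hx hy => by
    set z := (P.mulRightIsometry x hx).symm y
    have hz : ‖z‖ = 1 := by rw [LinearIsometryEquiv.norm_map, hy]
    exact ⟨P.mulLeftIsometry z hz, (P.mulRightIsometry x hx).apply_symm_apply y⟩)
  simp only [← sq, ← hb, map_add, map_sub, LinearMap.add_apply, LinearMap.sub_apply]
  ring

/-- A four-dimensional absolute-valued algebra is an orthogonal isotope of the quaternions. -/
theorem exists_isotopy_quaternion (P : AbsoluteValuedAlgebra A) (hdim : Module.finrank ℝ A = 4) :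
    ∃ (φ : A ≃ₗ[ℝ] ℍ[ℝ]) (f g : ℍ[ℝ] ≃ₗᵢ[ℝ] ℍ[ℝ]),
      ∀ x y, φ (P.mul x y) = f (φ x) * g (φ y) := by
  let _ : InnerProductSpace ℝ A := InnerProductSpace.ofNorm ℝ P.parallelogram_law
  have : Nontrivial A := Module.nontrivial_of_finrank_pos (R := ℝ) (by omega)
  obtain ⟨v, hv⟩ := exists_ne (0 : A)
  obtain ⟨e, he⟩ : ∃ e : A, ‖e‖ = 1 := ⟨‖v‖⁻¹ • v, norm_smul_inv_norm (𝕜 := ℝ) hv⟩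
  set R := P.mulRightIsometry e he with hR
  set L := P.mulLeftIsometry e he with hL
  -- Kaplansky's trick: `R_e⁻¹(x) L_e⁻¹(y)` still has multiplicative norm, and `e e` is a two-sided
  -- unit for it.
  let m : A →ₗ[ℝ] A →ₗ[ℝ] A := P.mul.compl₁₂ (R.symm.toLinearEquiv : A →ₗ[ℝ] A)
    (L.symm.toLinearEquiv : A →ₗ[ℝ] A)
  have hm : ∀ x y, m x y = P.mul (R.symm x) (L.symm y) := fun x y => rfl
  have hmR : ∀ x y, m (R x) (L y) = P.mul x y := fun x y => by simp [hm]
  obtain ⟨ψ, hψ, hψn⟩ := exists_quaternion_equiv_of_norm_mul (m := m) hdim (e := P.mul e e)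
    (fun x y => by rw [hm, P.norm_mul, LinearIsometryEquiv.norm_map, LinearIsometryEquiv.norm_map])
    (fun x => by
      obtain ⟨x, rfl⟩ := L.surjective x
      exact hmR e x)
    (fun x => by
      obtain ⟨x, rfl⟩ := R.surjective x
      exact hmR x e)
  let Ψ : ℍ[ℝ] ≃ₗᵢ[ℝ] A := ⟨ψ, hψn⟩
  refine ⟨ψ.symm, (Ψ.trans R).trans Ψ.symm, (Ψ.trans L).trans Ψ.symm, fun x y => ?_⟩
  rw [← hmR]
  apply ψ.injective
  rw [hψ, LinearEquiv.apply_symm_apply]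
  have h1 : ∀ z, ψ (Ψ.symm z) = z := Ψ.apply_symm_apply
  have h2 : ∀ z, Ψ (ψ.symm z) = z := ψ.apply_symm_apply
  simp only [LinearIsometryEquiv.trans_apply, h1, h2]

end Euclidean

section NormalForm

variable {A : Type*} [NormedAddCommGroup A] [NormedSpace ℝ A]

theorem unitary_mul_star_cancel (s : unitary ℍ[ℝ]) (x : ℍ[ℝ]) :
    (s : ℍ[ℝ]) * (star (s : ℍ[ℝ]) * x) = x := by
  rw [← mul_assoc, Unitary.mul_star_self_of_mem s.2, one_mul]

theorem unitary_star_mul_cancel (s : unitary ℍ[ℝ]) (x : ℍ[ℝ]) :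
    star (s : ℍ[ℝ]) * (s * x) = x := by
  rw [← mul_assoc, Unitary.star_mul_self_of_mem s.2, one_mul]

/-- The bijection `x ↦ s x t` of the quaternions, for `s` and `t` of norm one. -/
def unitaryMulMul (s t : unitary ℍ[ℝ]) : ℍ[ℝ] ≃ₗ[ℝ] ℍ[ℝ] where
  toFun x := s * x * t
  map_add' x y := by rw [mul_add, add_mul]
  map_smul' c x := by simp
  invFun x := star (s : ℍ[ℝ]) * x * star (t : ℍ[ℝ])
  left_inv x := by
    simp only [mul_assoc, unitary_star_mul_cancel, Unitary.mul_star_self_of_mem t.2, mul_one]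
  right_inv x := by
    simp only [mul_assoc, unitary_mul_star_cancel, Unitary.star_mul_self_of_mem t.2, mul_one]

theorem unitaryMulMul_apply (s t : unitary ℍ[ℝ]) (x : ℍ[ℝ]) : unitaryMulMul s t x = s * x * t :=
  rfl

/-- Four-dimensional absolute-valued algebras are principal isotopes of the four standard
isotopes of the quaternions. -/
theorem exists_normal_form [FiniteDimensional ℝ A] (P : AbsoluteValuedAlgebra A)
    (hdim : Module.finrank ℝ A = 4) :
    ∃ (φ : A ≃ₗ[ℝ] ℍ[ℝ]) (a b : unitary ℍ[ℝ]),
      (∀ x y, φ (P.mul x y) = a * φ x * φ y * b) ∨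
      (∀ x y, φ (P.mul x y) = a * φ x * b * star (φ y)) ∨
      (∀ x y, φ (P.mul x y) = star (φ x) * a * φ y * b) ∨
      (∀ x y, φ (P.mul x y) = a * star (φ x) * star (φ y) * b) := by
  obtain ⟨φ, f, g, hφ⟩ := P.exists_isotopy_quaternion hdim
  obtain ⟨p, q, hf⟩ := Quaternion.linearIsometryEquiv_eq_mul_mul f
  obtain ⟨r, s, hg⟩ := Quaternion.linearIsometryEquiv_eq_mul_mul g
  have h1 := unitary_mul_star_cancel
  have h2 := unitary_star_mul_cancel
  -- In each case the new coordinate `s φ t` is chosen to absorb the constants standing in the wrong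
  -- places.
  rcases hf with hf | hf <;> rcases hg with hg | hg
  · refine ⟨φ.trans (unitaryMulMul 1 (q * r)), p, star (q * r) * (s * (q * r)), Or.inl fun x y => ?_⟩
    simp [unitaryMulMul_apply, hφ, hf, hg, mul_assoc, h1]
  · refine ⟨φ.trans (unitaryMulMul (star s) 1), star s * p * s, q * r, Or.inr (Or.inl fun x y => ?_)⟩
    simp [unitaryMulMul_apply, hφ, hf, hg, mul_assoc, h1]
  · refine ⟨φ.trans (unitaryMulMul 1 (star p)), q * r, p * s * star p,
      Or.inr (Or.inr (Or.inl fun x y => ?_))⟩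
    simp [unitaryMulMul_apply, hφ, hf, hg, mul_assoc, h2]
  · refine ⟨φ.trans (unitaryMulMul 1 (star (q * r))), p * star (q * r), s * star (q * r),
      Or.inr (Or.inr (Or.inr fun x y => ?_))⟩
    simp [unitaryMulMul_apply, hφ, hf, hg, mul_assoc, h2]

end NormalForm

end AbsoluteValuedAlgebra

end

/-! ### Norm-one quaternions in coordinates. -/

noncomputable section

namespace Quaternion

theorem unitary_re_sq_add (a : unitary ℍ[ℝ]) :
    (a : ℍ[ℝ]).re ^ 2 + (a : ℍ[ℝ]).imI ^ 2 + (a : ℍ[ℝ]).imJ ^ 2 + (a : ℍ[ℝ]).imK ^ 2 = 1 := by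
  rw [← Quaternion.normSq_def', Quaternion.normSq_eq_norm_mul_self, CStarRing.norm_coe_unitary,
    one_mul]

/-- The quaternion with the given coordinates. -/
def ofCoords (r x y z : ℝ) : ℍ[ℝ] := ⟨r, x, y, z⟩

@[simp] theorem re_ofCoords (r x y z : ℝ) : (ofCoords r x y z).re = r := rfl

@[simp] theorem imI_ofCoords (r x y z : ℝ) : (ofCoords r x y z).imI = x := rfl

@[simp] theorem imJ_ofCoords (r x y z : ℝ) : (ofCoords r x y z).imJ = y := rfl

@[simp] theorem imK_ofCoords (r x y z : ℝ) : (ofCoords r x y z).imK = z := rfl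

theorem quatI_eq_ofCoords : AbsoluteValuedAlgebra.quatI = ofCoords 0 1 0 0 := rfl

/-- The norm-one quaternion with the given coordinates. -/
def unitaryMk (r x y z : ℝ) (h : r ^ 2 + x ^ 2 + y ^ 2 + z ^ 2 = 1) : unitary ℍ[ℝ] :=
  ⟨ofCoords r x y z, Unitary.mem_iff.2 (by
    rw [Quaternion.star_mul_self, Quaternion.self_mul_star, Quaternion.normSq_def',
      re_ofCoords, imI_ofCoords, imJ_ofCoords, imK_ofCoords, h]; simp)⟩

theorem coe_unitaryMk (r x y z : ℝ) (h : r ^ 2 + x ^ 2 + y ^ 2 + z ^ 2 = 1) :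
    (unitaryMk r x y z h : ℍ[ℝ]) = ofCoords r x y z := rfl

theorem unitary_eq_one_or_eq_neg_one {a : unitary ℍ[ℝ]} (hi : (a : ℍ[ℝ]).imI = 0)
    (hj : (a : ℍ[ℝ]).imJ = 0) (hk : (a : ℍ[ℝ]).imK = 0) : a = 1 ∨ a = -1 := by
  have h := unitary_re_sq_add a
  rw [hi, hj, hk] at h
  have h' : (a : ℍ[ℝ]).re = 1 ∨ (a : ℍ[ℝ]).re = -1 := by
    rw [← mul_self_eq_one_iff]; linarith
  refine h'.imp (fun h1 => Subtype.ext ?_) (fun h1 => Subtype.ext ?_)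
  · ext <;> simp [h1, hi, hj, hk]
  · rw [Unitary.coe_neg]
    ext <;> simp [h1, hi, hj, hk]

theorem unitary_eq_one_or_eq_neg_one_of_comm {a : unitary ℍ[ℝ]}
    (h : ∀ x : unitary ℍ[ℝ], x * x = -1 → a * x = x * a) : a = 1 ∨ a = -1 := by
  have hi := congrArg Subtype.val (h (unitaryMk 0 1 0 0 (by norm_num))
    (Subtype.ext (by rw [Unitary.coe_neg]; ext <;> simp [coe_unitaryMk])))
  have hj := congrArg Subtype.val (h (unitaryMk 0 0 1 0 (by norm_num))
    (Subtype.ext (by rw [Unitary.coe_neg]; ext <;> simp [coe_unitaryMk])))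
  simp only [Submonoid.coe_mul, coe_unitaryMk, Quaternion.ext_iff, Quaternion.re_mul,
    Quaternion.imI_mul, Quaternion.imJ_mul, Quaternion.imK_mul, re_ofCoords, imI_ofCoords, imJ_ofCoords,
    imK_ofCoords] at hi hj
  exact unitary_eq_one_or_eq_neg_one (by linarith) (by linarith) (by linarith)

theorem unitary_eq_one_or_eq_neg_one_of_comm_mul_self {a : unitary ℍ[ℝ]}
    (h : ∀ x : unitary ℍ[ℝ], a * (x * x) = x * x * a) : a = 1 ∨ a = -1 := by
  -- The squares of `(3 + 4i)/5` and `(3 + 4j)/5` are not real, unlike those of `i` and `j`.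
  have hi := congrArg Subtype.val (h (unitaryMk (3 / 5) (4 / 5) 0 0 (by norm_num)))
  have hj := congrArg Subtype.val (h (unitaryMk (3 / 5) 0 (4 / 5) 0 (by norm_num)))
  simp only [Submonoid.coe_mul, coe_unitaryMk, Quaternion.ext_iff, Quaternion.re_mul,
    Quaternion.imI_mul, Quaternion.imJ_mul, Quaternion.imK_mul, re_ofCoords, imI_ofCoords, imJ_ofCoords,
    imK_ofCoords] at hi hj
  exact unitary_eq_one_or_eq_neg_one (by linarith) (by linarith) (by linarith)

/-- A norm-one quaternion commuting with all conjugates of `b` is central, unless `b` is. -/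
theorem unitary_central_of_comm_conj {a b : unitary ℍ[ℝ]}
    (h : ∀ x : unitary ℍ[ℝ], a * (x * b * x⁻¹) = x * b * x⁻¹ * a) :
    (a = 1 ∨ a = -1) ∨ (b = 1 ∨ b = -1) := by
  -- The relation is homogeneous in `x`, so it may be tested at quaternions that are not normalized,
  -- such as `1 + i`.
  have h' : ∀ x : ℍ[ℝ], (a : ℍ[ℝ]) * (x * b * star x) = x * b * star x * a := by
    intro x
    by_cases hx : x = 0
    · simp [hx]
    obtain ⟨u, hu⟩ := exists_unitary_smul_eq hx
    have : (a : ℍ[ℝ]) * (u * b * star (u : ℍ[ℝ])) = u * b * star (u : ℍ[ℝ]) * a :=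
      congrArg Subtype.val (h u)
    rw [hu]
    simp only [star_smul, smul_mul_assoc, mul_smul_comm, this]
  have e0 := h' 1
  have e1 := h' (ofCoords 1 1 0 0)
  have e2 := h' (ofCoords 1 0 1 0)
  have e3 := h' (ofCoords 1 0 0 1)
  have e4 := h' (ofCoords 0 1 0 0)
  have e5 := h' (ofCoords 0 0 1 0)
  have e6 := h' (ofCoords 0 0 0 1)
  simp [Quaternion.ext_iff] at e0 e1 e2 e3 e4 e5 e6
  have keyI : (a : ℍ[ℝ]).imI * (b : ℍ[ℝ]).imI = 0 ∧ (a : ℍ[ℝ]).imI * (b : ℍ[ℝ]).imJ = 0 ∧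
      (a : ℍ[ℝ]).imI * (b : ℍ[ℝ]).imK = 0 := ⟨by linarith, by linarith, by linarith⟩
  have keyJ : (a : ℍ[ℝ]).imJ * (b : ℍ[ℝ]).imI = 0 ∧ (a : ℍ[ℝ]).imJ * (b : ℍ[ℝ]).imJ = 0 ∧
      (a : ℍ[ℝ]).imJ * (b : ℍ[ℝ]).imK = 0 := ⟨by linarith, by linarith, by linarith⟩
  have keyK : (a : ℍ[ℝ]).imK * (b : ℍ[ℝ]).imI = 0 ∧ (a : ℍ[ℝ]).imK * (b : ℍ[ℝ]).imJ = 0 ∧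
      (a : ℍ[ℝ]).imK * (b : ℍ[ℝ]).imK = 0 := ⟨by linarith, by linarith, by linarith⟩
  by_cases hb : (b : ℍ[ℝ]).imI = 0 ∧ (b : ℍ[ℝ]).imJ = 0 ∧ (b : ℍ[ℝ]).imK = 0
  · exact Or.inr (unitary_eq_one_or_eq_neg_one hb.1 hb.2.1 hb.2.2)
  · have hzero : ∀ r : ℝ, r * (b : ℍ[ℝ]).imI = 0 ∧ r * (b : ℍ[ℝ]).imJ = 0 ∧
        r * (b : ℍ[ℝ]).imK = 0 → r = 0 := fun r hr => by
      by_contra hr0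
      simp only [mul_eq_zero, hr0, false_or] at hr
      exact hb hr
    exact Or.inl (unitary_eq_one_or_eq_neg_one (hzero _ keyI) (hzero _ keyJ) (hzero _ keyK))

/-- The imaginary part of `b²` is `2 Re(b) Im(b)`, and centrality makes it vanish. -/
theorem unitary_mul_self_central {b : unitary ℍ[ℝ]} 
    (h : ∀ x : unitary ℍ[ℝ], x * (b * b) = b * b * x) :
    (b = 1 ∨ b = -1) ∨ (b : ℍ[ℝ]).re = 0 := by
  have hi := congrArg Subtype.val (h (unitaryMk 0 1 0 0 (by norm_num)))
  have hj := congrArg Subtype.val (h (unitaryMk 0 0 1 0 (by norm_num)))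
  simp only [Submonoid.coe_mul, coe_unitaryMk, Quaternion.ext_iff, Quaternion.re_mul,
    Quaternion.imI_mul, Quaternion.imJ_mul, Quaternion.imK_mul, re_ofCoords, imI_ofCoords, imJ_ofCoords,
    imK_ofCoords] at hi hj
  by_cases hb : (b : ℍ[ℝ]).re = 0
  · exact Or.inr hb
  · exact Or.inl (unitary_eq_one_or_eq_neg_one
      (mul_left_cancel₀ hb (by linarith)) (mul_left_cancel₀ hb (by linarith))
      (mul_left_cancel₀ hb (by linarith)))

/-- Imaginary norm-one quaternions are conjugate to `i`. -/
theorem exists_unitary_conj_eq_quatI {b : unitary ℍ[ℝ]} (hb : (b : ℍ[ℝ]).re = 0) :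
    ∃ c : unitary ℍ[ℝ], (c : ℍ[ℝ]) * b = AbsoluteValuedAlgebra.quatI * c := by
  have hn := unitary_re_sq_add b
  rw [hb] at hn
  -- Since `b² = -1`, the element `d = 1 - i b` satisfies `d b = i d`; it vanishes only for `b =
  -- -i`, where `j` serves instead.
  by_cases hbi : (b : ℍ[ℝ]).imI = -1
  · have h2 : (b : ℍ[ℝ]).imJ = 0 := by
      rw [hbi] at hn; nlinarith [sq_nonneg (b : ℍ[ℝ]).imJ, sq_nonneg (b : ℍ[ℝ]).imK]
    have h3 : (b : ℍ[ℝ]).imK = 0 := by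
      rw [hbi] at hn; nlinarith [sq_nonneg (b : ℍ[ℝ]).imJ, sq_nonneg (b : ℍ[ℝ]).imK]
    refine ⟨unitaryMk 0 0 1 0 (by norm_num), ?_⟩
    ext <;> simp [coe_unitaryMk, quatI_eq_ofCoords, hb, hbi, h2, h3]
  · set d : ℍ[ℝ] := 1 - AbsoluteValuedAlgebra.quatI * b with hd
    have hd0 : d ≠ 0 := fun h0 => by
      have := congrArg QuaternionAlgebra.re h0
      simp [hd, quatI_eq_ofCoords] at this
      exact hbi (by linarith)
    have hdb : d * b = AbsoluteValuedAlgebra.quatI * d := by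
      ext <;> simp [hd, quatI_eq_ofCoords, hb] <;> linarith
    obtain ⟨u, hu⟩ := exists_unitary_smul_eq hd0
    refine ⟨u, smul_right_injective ℍ[ℝ] (norm_ne_zero_iff.2 hd0) ?_⟩
    change ‖d‖ • ((u : ℍ[ℝ]) * b) = ‖d‖ • (AbsoluteValuedAlgebra.quatI * (u : ℍ[ℝ]))
    rw [← smul_mul_assoc, ← mul_smul_comm, ← hu, hdb]

end Quaternion

/-! ### The four normal forms under the associator identity. -/

namespace AbsoluteValuedAlgebra

variable {A : Type*} [NormedAddCommGroup A] [NormedSpace ℝ A]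

/-- Transfers the identity to the group of norm-one quaternions, where the lemmas on groups apply.
-/
theorem assoc_eq_of_coordinates {P : AbsoluteValuedAlgebra A} {φ : A ≃ₗ[ℝ] ℍ[ℝ]}
    {m : ℍ[ℝ] → ℍ[ℝ] → ℍ[ℝ]} (hφ : ∀ x y, φ (P.mul x y) = m (φ x) (φ y))
    (hP : ∀ x : A, P.assoc x (P.square x) (P.square x) = 0)
    {M : unitary ℍ[ℝ] → unitary ℍ[ℝ] → unitary ℍ[ℝ]} (hM : ∀ x y, (M x y : ℍ[ℝ]) = m x y)
    (x : unitary ℍ[ℝ]) : M (M x (M x x)) (M x x) = M x (M (M x x) (M x x)) := by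
  have h := congrArg φ (sub_eq_zero.1 (hP (φ.symm x)))
  simp only [square, hφ, LinearEquiv.apply_symm_apply] at h
  exact Subtype.ext (by simpa only [hM] using h)

theorem assoc_eq_zero_of_isomorphic {B : Type*} [NormedAddCommGroup B] [NormedSpace ℝ B]
    {P : AbsoluteValuedAlgebra A} {Q : AbsoluteValuedAlgebra B} (h : P.Isomorphic Q)
    (hQ : ∀ x : B, Q.assoc x (Q.square x) (Q.square x) = 0) (x : A) :
    P.assoc x (P.square x) (P.square x) = 0 := by
  obtain ⟨φ, hφ⟩ := h
  apply φ.injective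
  have := hQ (φ x)
  simpa only [assoc, square, map_sub, map_zero, hφ] using this

theorem assoc_quaternion (x : ℍ[ℝ]) :
    quaternion.assoc x (quaternion.square x) (quaternion.square x) = 0 := by
  simp [assoc, square, quaternion, mul_assoc]

theorem assoc_quaternionStar (x : ℍ[ℝ]) :
    quaternionStar.assoc x (quaternionStar.square x) (quaternionStar.square x) = 0 := by
  simp only [assoc, square, quaternionStar, LinearMap.mk₂_apply]
  simp [mul_assoc]

/-- With `s = x i x̄` the square of `x`, both `s` and `i` are imaginary, and both bracketings equal
`x i s i s`. -/
theorem assoc_principalStar_one_quatI (x : ℍ[ℝ]) :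
    (principalStar 1 quatI norm_one norm_quatI).assoc x
      ((principalStar 1 quatI norm_one norm_quatI).square x)
      ((principalStar 1 quatI norm_one norm_quatI).square x) = 0 := by
  have hI : star quatI = -quatI := by ext <;> simp [Quaternion.quatI_eq_ofCoords]
  simp only [assoc, square, principalStar, LinearMap.mk₂_apply]
  simp [mul_assoc, hI]

/-- Negation is an isomorphism between a product and its opposite in sign; this disposes of the
signs of `a` and `b`. -/
theorem isomorphic_of_neg {B : Type*} [NormedAddCommGroup B] [NormedSpace ℝ B]
    {P : AbsoluteValuedAlgebra A} {Q : AbsoluteValuedAlgebra B} (φ : A ≃ₗ[ℝ] B)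
    (h : (∀ x y, φ (P.mul x y) = Q.mul (φ x) (φ y)) ∨
      ∀ x y, φ (P.mul x y) = -Q.mul (φ x) (φ y)) : P.Isomorphic Q := by
  rcases h with h | h
  · exact ⟨φ, h⟩
  · exact ⟨φ.trans (LinearEquiv.neg ℝ), fun x y => by simp [h]⟩

theorem isomorphic_quaternion_of_isotope {P : AbsoluteValuedAlgebra A} {φ : A ≃ₗ[ℝ] ℍ[ℝ]}
    {a b : unitary ℍ[ℝ]} (hφ : ∀ x y, φ (P.mul x y) = a * φ x * φ y * b)
    (hP : ∀ x : A, P.assoc x (P.square x) (P.square x) = 0) : P.Isomorphic quaternion := by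
  have h := assoc_eq_of_coordinates (m := fun x y => a * x * y * b)
    (M := fun x y => a * x * y * b) hφ hP (fun x y => rfl)
  have hab := mul_comm_of_isotope h
  have ha := Quaternion.unitary_eq_one_or_eq_neg_one_of_comm fun x hx =>
    mul_comm_of_isotope_of_mul_self_eq_neg_one hab hx (h x)
  have hb := Quaternion.unitary_eq_one_or_eq_neg_one_of_comm_mul_self fun x =>
    mul_mul_self_comm_of_isotope (by rcases ha with rfl | rfl <;> simp) (h x)
  apply isomorphic_of_neg φ
  rcases ha with rfl | rfl <;> rcases hb with rfl | rfl
  · exact Or.inl fun x y => by simp [hφ, quaternion]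
  · exact Or.inr fun x y => by simp [hφ, quaternion, Unitary.coe_neg]
  · exact Or.inr fun x y => by simp [hφ, quaternion, Unitary.coe_neg]
  · exact Or.inl fun x y => by simp [hφ, quaternion, Unitary.coe_neg]

theorem isomorphic_star_of_isotope {P : AbsoluteValuedAlgebra A} {φ : A ≃ₗ[ℝ] ℍ[ℝ]}
    {a b : unitary ℍ[ℝ]} (hφ : ∀ x y, φ (P.mul x y) = a * φ x * b * star (φ y))
    (hP : ∀ x : A, P.assoc x (P.square x) (P.square x) = 0) :
    P.Isomorphic quaternionStar ∨ P.Isomorphic (principalStar 1 quatI norm_one norm_quatI) := by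
  have h := assoc_eq_of_coordinates (m := fun x y => a * x * b * star y)
    (M := fun x y => a * x * b * y⁻¹) hφ hP (fun x y => rfl)
  have ha : a = 1 ∨ a = -1 := by
    rcases Quaternion.unitary_central_of_comm_conj (comm_conj_of_star_isotope h) with ha | hb
    · exact ha
    · exact Quaternion.unitary_eq_one_or_eq_neg_one_of_comm fun x _ =>
        comm_of_star_isotope hb (h x)
  rcases Quaternion.unitary_mul_self_central (fun x => mul_self_conj_of_star_isotope ha (h x))
    with hb | hb
  · refine Or.inl (isomorphic_of_neg φ ?_)
    rcases ha with rfl | rfl <;> rcases hb with rfl | rfl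
    · exact Or.inl fun x y => by simp [hφ, quaternionStar]
    · exact Or.inr fun x y => by simp [hφ, quaternionStar, Unitary.coe_neg]
    · exact Or.inr fun x y => by simp [hφ, quaternionStar, Unitary.coe_neg]
    · exact Or.inl fun x y => by simp [hφ, quaternionStar, Unitary.coe_neg]
  · obtain ⟨c, hc⟩ := Quaternion.exists_unitary_conj_eq_quatI hb
    have hc' : ∀ z : ℍ[ℝ], (c : ℍ[ℝ]) * (b * z) = quatI * (c * z) := fun z => by
      rw [← mul_assoc, hc, mul_assoc]
    -- Conjugation by `c` carries `b` to `i` and fixes `a = ±1`.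
    refine Or.inr (isomorphic_of_neg (φ.trans (unitaryMulMul c (star c))) ?_)
    rcases ha with rfl | rfl
    · exact Or.inl fun x y => by
        simp [hφ, principalStar, unitaryMulMul_apply, mul_assoc, ← hc', unitary_star_mul_cancel]
    · exact Or.inr fun x y => by
        simp [hφ, principalStar, unitaryMulMul_apply, mul_assoc, ← hc', unitary_star_mul_cancel,
          Unitary.coe_neg]

theorem not_inv_isotope {P : AbsoluteValuedAlgebra A} {φ : A ≃ₗ[ℝ] ℍ[ℝ]}
    {a b : unitary ℍ[ℝ]} (hφ : ∀ x y, φ (P.mul x y) = star (φ x) * a * φ y * b)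
    (hP : ∀ x : A, P.assoc x (P.square x) (P.square x) = 0) : False := by
  have h := assoc_eq_of_coordinates (m := fun x y => star x * a * y * b)
    (M := fun x y => x⁻¹ * a * y * b) hφ hP (fun x y => rfl)
  have haa := mul_self_eq_one_of_inv_isotope h
  have ha : a = 1 ∨ a = -1 := by
    have e := congrArg Subtype.val haa
    exact (mul_self_eq_one_iff.1 e).imp Subtype.ext (fun h => Subtype.ext h)
  -- Now `x² = b²` for every norm-one `x`; the values 1 and `i` give `1 = -1`.
  have h1 := mul_self_eq_of_inv_isotope ha (h 1)
  have h2 := mul_self_eq_of_inv_isotope ha (h (Quaternion.unitaryMk 0 1 0 0 (by norm_num)))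
  rw [← h1] at h2
  have h3 := congrArg (fun u : unitary ℍ[ℝ] => (u : ℍ[ℝ]).re) h2
  simp [Quaternion.coe_unitaryMk] at h3
  norm_num at h3

theorem not_inv_inv_isotope {P : AbsoluteValuedAlgebra A} {φ : A ≃ₗ[ℝ] ℍ[ℝ]}
    {a b : unitary ℍ[ℝ]} (hφ : ∀ x y, φ (P.mul x y) = a * star (φ x) * star (φ y) * b)
    (hP : ∀ x : A, P.assoc x (P.square x) (P.square x) = 0) : False := by
  have h := assoc_eq_of_coordinates (m := fun x y => a * star x * star y * b)
    (M := fun x y => a * x⁻¹ * y⁻¹ * b) hφ hP (fun x y => rfl)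
  obtain ⟨c, hc⟩ : ∃ c : unitary ℍ[ℝ], c = b⁻¹ * a * b := ⟨_, rfl⟩
  have hi := congrArg Subtype.val (anticomm_of_inv_inv_isotope h
    (x := Quaternion.unitaryMk 0 1 0 0 (by norm_num))
    (Subtype.ext (by rw [Unitary.coe_neg]; ext <;> simp [Quaternion.coe_unitaryMk])))
  have hj := congrArg Subtype.val (anticomm_of_inv_inv_isotope h
    (x := Quaternion.unitaryMk 0 0 1 0 (by norm_num))
    (Subtype.ext (by rw [Unitary.coe_neg]; ext <;> simp [Quaternion.coe_unitaryMk])))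
  have hk := congrArg Subtype.val (anticomm_of_inv_inv_isotope h
    (x := Quaternion.unitaryMk 0 0 0 1 (by norm_num))
    (Subtype.ext (by rw [Unitary.coe_neg]; ext <;> simp [Quaternion.coe_unitaryMk])))
  rw [← hc] at hi hj hk
  have hn := Quaternion.unitary_re_sq_add c
  simp [Unitary.coe_neg, Quaternion.coe_unitaryMk, Quaternion.ext_iff] at hi hj hk
  -- Anticommuting with `i`, `j` and `k` forces `c = 0`, against its norm 1.
  have e0 : (c : ℍ[ℝ]).re = 0 := by linarith
  have e1 : (c : ℍ[ℝ]).imI = 0 := by linarith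
  have e2 : (c : ℍ[ℝ]).imJ = 0 := by linarith
  have e3 : (c : ℍ[ℝ]).imK = 0 := by linarith
  rw [e0, e1, e2, e3] at hn
  norm_num at hn

end AbsoluteValuedAlgebra

end

theorem theorem3p15 {A : Type*} [NormedAddCommGroup A] [NormedSpace ℝ A]
    (P : AbsoluteValuedAlgebra A) (hdim : Module.finrank ℝ A = 4) :
    (∀ x : A, P.assoc x (P.square x) (P.square x) = 0) ↔
      (P.Isomorphic AbsoluteValuedAlgebra.quaternion ∨
        P.Isomorphic AbsoluteValuedAlgebra.quaternionStar ∨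
        P.Isomorphic (AbsoluteValuedAlgebra.principalStar 1 AbsoluteValuedAlgebra.quatI
          norm_one AbsoluteValuedAlgebra.norm_quatI)) := by
  have : FiniteDimensional ℝ A := Module.finite_of_finrank_pos (by omega)
  constructor
  · intro hP
    obtain ⟨φ, a, b, hφ | hφ | hφ | hφ⟩ := P.exists_normal_form hdim
    · exact Or.inl (AbsoluteValuedAlgebra.isomorphic_quaternion_of_isotope hφ hP)
    · exact Or.inr (AbsoluteValuedAlgebra.isomorphic_star_of_isotope hφ hP)
    · exact (AbsoluteValuedAlgebra.not_inv_isotope hφ hP).elim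
    · exact (AbsoluteValuedAlgebra.not_inv_inv_isotope hφ hP).elim
  · rintro (h | h | h)
    · exact AbsoluteValuedAlgebra.assoc_eq_zero_of_isomorphic h
        AbsoluteValuedAlgebra.assoc_quaternion
    · exact AbsoluteValuedAlgebra.assoc_eq_zero_of_isomorphic h
        AbsoluteValuedAlgebra.assoc_quaternionStar
    · exact AbsoluteValuedAlgebra.assoc_eq_zero_of_isomorphic h
        AbsoluteValuedAlgebra.assoc_principalStar_one_quatI
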